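/- Synthetic algebraic geometry works in an intuitionistic internal language with a fixed commutative ring $R$. Its duality axiom says that for every finitely presented $R$-algebra $A$ the map $A\to R^{\operatorname{Spec}A}$, $a\mapsto(\chi\mapsto\chi(a))$, is an isomorphism, where $\operatorname{Spec}A=\operatorname{Hom}_{R\text{-Alg}}(A,R)$. The result is stated here in an arbitrary sheaf topos modelling this axiom; all notions are those of the internal language, i.e. universal quantifiers range over all stages and existence means existence on a covering. **Setting.** Let $(\mathcal C,J)$ be a small site and $R$ a sheaf of commutative rings on it that satisfies the duality axiom, that is: for every object $U$, all $n,l\in\mathbb N$ and $P_1,\dots,P_l\in R(U)[X_1,\dots,X_n]$, let $\operatorname{Spec}A$ be the sheaf over $U$ with $\operatorname{Spec}A(V)=\{x\in R(V)^n: P_1(x)=\dots=P_l(x)=0\}$ for $V\to U$; then (i) every $F\in R(U)[X_1,\dots,X_n]$ that vanishes on $\operatorname{Spec}A(V)$ for all $V\to U$ lies, on a covering of $U$, in the ideal $(P_1,\dots,P_l)$, and (ii) every morphism of sheaves $\operatorname{Spec}A\to R|_U$ is, on a covering of $U$, given by a polynomial. "Module" means sheaf of $R$-modules; a linear map $M\to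 N$ over $U$ is a morphism of sheaves of modules $M|_U\to N|_U$; $M^\star=\mathcal Hom_R(M,R)$ is the dual (internal Hom) module; surjectivity and exactness are those of sheaves. $M$ is finitely presented over $U$ if, on a covering of $U$, there is an exact sequence $R^m\to R^n\to M\to 0$, and finitely copresented over $U$ if, on a covering of $U$, there is an exact sequence $0\to M\to R^n\to R^m$. **Statement.** Let $M$ be an $R$-module and $U$ an object of $\mathcal C$. 1. If $0\to M\xrightarrow{\varphi}R^n\xrightarrow{P}R^m$ is an exact sequence over $U$, then the dual sequence $(R^m)^\star\xrightarrow{P^\star}(R^n)^\star\xrightarrow{\varphi^\star}M^\star\to 0$ is exact over $U$. 2. In particular, if $M$ is finitely copresented over $U$, then $M^\star$ is finitely presented over $U$. 3. If $M$ is finitely presented or finitely copresented over $U$, then the canonical map $M\to M^{\star\star}$, $x\mapsto(\xi\mapsto\xi(x))$, is an isomorphism over $U$. -/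

import Mathlib

open CategoryTheory Opposite

universe u v w

/-! ### Sections of a sheaf of commutative rings -/

section Rings

variable {C : Type u} [Category.{v} C] {J : GrothendieckTopology C}

/-- The ring `R(U)` of sections of `R` over the stage `U`. -/
abbrev ringSec (R : Sheaf J CommRingCat.{w}) (U : C) : CommRingCat.{w} := R.obj.obj (op U)

/-- The restriction homomorphism `R(U) → R(V)` along `f : V ⟶ U`. -/
abbrev ringRes (R : Sheaf J CommRingCat.{w}) {U V : C} (f : V ⟶ U) :
    ringSec R U →+* ringSec R V :=
  (R.obj.map f.op).hom

theorem ringRes_id (R : Sheaf J CommRingCat.{w}) {U : C} (r : ringSec R U) :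
    ringRes R (𝟙 U) r = r := by
  simp [ringRes]

theorem ringRes_comp (R : Sheaf J CommRingCat.{w}) {U V W : C} (f : V ⟶ U) (g : W ⟶ V)
    (r : ringSec R U) : ringRes R (g ≫ f) r = ringRes R g (ringRes R f r) := by
  simp [ringRes]

/-! ### The duality axiom -/

/-- The points over `f : V ⟶ U` of `Spec A`, where `A = R[X₁,…,Xₙ]/(p₁,…,pₗ)` is the finitely
presented algebra over `R|_U` given by polynomials `pᵢ` with coefficients in `R(U)`: the common
zeros of the `pᵢ` in `R(V)ⁿ`. By `specPointsEquiv` below these are the `R(V)`-algebra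
homomorphisms `R(V)[X₁,…,Xₙ]/(p₁|_V,…,pₗ|_V) → R(V)`. -/
def SpecPoints (R : Sheaf J CommRingCat.{w}) {U : C} {n l : ℕ}
    (p : Fin l → MvPolynomial (Fin n) (ringSec R U)) {V : C} (f : V ⟶ U) : Type w :=
  {x : Fin n → ringSec R V // ∀ i, MvPolynomial.eval x (MvPolynomial.map (ringRes R f) (p i)) = 0}

/-- The ideal `(p₁|_V,…,pₗ|_V)` of `R(V)[X₁,…,Xₙ]`. -/
noncomputable def relIdeal (R : Sheaf J CommRingCat.{w}) {U : C} {n l : ℕ}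
    (p : Fin l → MvPolynomial (Fin n) (ringSec R U)) {V : C} (f : V ⟶ U) :
    Ideal (MvPolynomial (Fin n) (ringSec R V)) :=
  Ideal.span (Set.range fun i => MvPolynomial.map (ringRes R f) (p i))

/-- `Spec A = Hom_{R-Alg}(A, R)`, stage by stage. -/
noncomputable def specPointsEquiv (R : Sheaf J CommRingCat.{w}) {U : C} {n l : ℕ}
    (p : Fin l → MvPolynomial (Fin n) (ringSec R U)) {V : C} (f : V ⟶ U) :
    ((MvPolynomial (Fin n) (ringSec R V) ⧸ relIdeal R p f) →ₐ[ringSec R V] ringSec R V) ≃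
      SpecPoints R p f where
  toFun χ := ⟨fun j => χ (Ideal.Quotient.mk _ (MvPolynomial.X j)), fun i => by
    have h : (χ.comp (Ideal.Quotient.mkₐ (ringSec R V) (relIdeal R p f))) =
        MvPolynomial.aeval (fun j => χ (Ideal.Quotient.mk _ (MvPolynomial.X j))) := by
      ext j
      simp
    have h2 := DFunLike.congr_fun h (MvPolynomial.map (ringRes R f) (p i))
    rw [MvPolynomial.aeval_eq_eval] at h2
    refine Eq.trans h2.symm ?_
    rw [AlgHom.comp_apply]
    have h3 : (Ideal.Quotient.mkₐ (ringSec R V) (relIdeal R p f))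
        (MvPolynomial.map (ringRes R f) (p i)) = 0 :=
      Ideal.Quotient.eq_zero_iff_mem.2 (Ideal.subset_span ⟨i, rfl⟩)
    rw [h3, map_zero]⟩
  invFun x := Ideal.Quotient.liftₐ (relIdeal R p f) (MvPolynomial.aeval x.1) (by
    intro a ha
    have : relIdeal R p f ≤ RingHom.ker (MvPolynomial.aeval (R := ringSec R V) x.1) := by
      rw [relIdeal, Ideal.span_le]
      rintro _ ⟨i, rfl⟩
      have := x.2 i
      rw [← MvPolynomial.aeval_eq_eval] at this
      exact this
    exact this ha)
  left_inv χ := by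
    apply Ideal.Quotient.algHom_ext
    ext j
    exact MvPolynomial.aeval_X _ j
  right_inv x := by
    apply Subtype.ext
    funext j
    exact MvPolynomial.aeval_X _ j

/-- The restriction `Spec A (V) → Spec A (W)` along `g : W ⟶ V`. -/
def SpecPoints.res {R : Sheaf J CommRingCat.{w}} {U : C} {n l : ℕ}
    {p : Fin l → MvPolynomial (Fin n) (ringSec R U)} {V W : C} {f : V ⟶ U} (g : W ⟶ V)
    (x : SpecPoints R p f) : SpecPoints R p (g ≫ f) :=
  ⟨fun j => ringRes R g (x.1 j), fun i => by
    have h : ringRes R (g ≫ f) = (ringRes R g).comp (ringRes R f) :=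
      RingHom.ext fun r => ringRes_comp R f g r
    rw [h, ← MvPolynomial.map_map, MvPolynomial.eval_map]
    have h2 := MvPolynomial.eval₂_comp_left (ringRes R g) (RingHom.id _) x.1
      (MvPolynomial.map (ringRes R f) (p i))
    have h3 : MvPolynomial.eval₂ (RingHom.id _) x.1 (MvPolynomial.map (ringRes R f) (p i)) = 0 :=
      x.2 i
    rw [h3, map_zero, RingHom.comp_id] at h2
    exact h2.symm⟩

/-- The sections over `U` of the function algebra `R^{Spec A}` (the exponential in the category
of sheaves): families of functions `Spec A (V) → R(V)`, one for each `f : V ⟶ U`, compatible with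
restriction. -/
structure SpecFun (R : Sheaf J CommRingCat.{w}) {U : C} {n l : ℕ}
    (p : Fin l → MvPolynomial (Fin n) (ringSec R U)) where
  app : ∀ {V : C} (f : V ⟶ U), SpecPoints R p f → ringSec R V
  naturality : ∀ {V W : C} (f : V ⟶ U) (g : W ⟶ V) (x : SpecPoints R p f),
    ringRes R g (app f x) = app (g ≫ f) (x.res g)

/-- The duality axiom for a sheaf of commutative rings `R` on a site, as a statement of the
internal language of the category of sheaves: for all finitely presented `R`-algebras
`A = R[X₁,…,Xₙ]/(p₁,…,pₗ)`, the canonical homomorphism `A → R^{Spec A}`, which sends `a` to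
`χ ↦ χ(a)`, is an isomorphism. Universal quantifiers range over all stages `U` and existential
ones mean existence on a covering. As `A` is the sheaf associated with
`V ↦ R(V)[X₁,…,Xₙ]/(p₁|_V,…,pₗ|_V)`, injectivity says that a polynomial which vanishes on `Spec A`
locally lies in the ideal of relations, and surjectivity says that any function on `Spec A` is
locally given by a polynomial. -/
structure SatisfiesDuality (R : Sheaf J CommRingCat.{w}) : Prop where
  injective : ∀ (U : C) (n l : ℕ) (p : Fin l → MvPolynomial (Fin n) (ringSec R U))
    (F : MvPolynomial (Fin n) (ringSec R U)),
    (∀ (V : C) (f : V ⟶ U) (x : SpecPoints R p f),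
      MvPolynomial.eval x.1 (MvPolynomial.map (ringRes R f) F) = 0) →
    ∃ S ∈ J U, ∀ (V : C) (f : V ⟶ U), S f →
      MvPolynomial.map (ringRes R f) F ∈ relIdeal R p f
  surjective : ∀ (U : C) (n l : ℕ) (p : Fin l → MvPolynomial (Fin n) (ringSec R U))
    (s : SpecFun R p),
    ∃ S ∈ J U, ∀ (V : C) (f : V ⟶ U), S f →
      ∃ F : MvPolynomial (Fin n) (ringSec R V),
        ∀ (W : C) (g : W ⟶ V) (x : SpecPoints R p (g ≫ f)),
          s.app (g ≫ f) x = MvPolynomial.eval x.1 (MvPolynomial.map (ringRes R g) F)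

end Rings

/-! ### Sheaves of modules and their internal linear maps -/

section Modules

variable {C : Type u} [SmallCategory C] {J : GrothendieckTopology C}

/-- `R`-modules in the category of sheaves: sheaves of modules over the sheaf of commutative
rings `R`. -/
abbrev ModSheaf (R : Sheaf J CommRingCat.{u}) :=
  SheafOfModules.{u} ((sheafCompose J (forget₂ CommRingCat.{u} RingCat.{u})).obj R)

variable {R : Sheaf J CommRingCat.{u}}

/-- The `R(U)`-module `M(U)` of sections of `M` over `U`. -/
def ModSheaf.sec (M : ModSheaf R) (U : C) : Type u := M.val.obj (op U)

instance (M : ModSheaf R) (U : C) : AddCommGroup (M.sec U) :=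
  inferInstanceAs (AddCommGroup (M.val.obj (op U)))

instance (M : ModSheaf R) (U : C) : Module (ringSec R U) (M.sec U) :=
  (M.val.obj (op U)).isModule

/-- The restriction map `M(U) → M(V)` along `f : V ⟶ U`. -/
noncomputable def ModSheaf.res (M : ModSheaf R) {U V : C} (f : V ⟶ U) : M.sec U →+ M.sec V :=
  (M.val.presheaf.map f.op).hom

theorem ModSheaf.res_id (M : ModSheaf R) {U : C} (x : M.sec U) : M.res (𝟙 U) x = x :=
  ConcreteCategory.congr_hom (M.val.presheaf.map_id (op U)) x

theorem ModSheaf.res_comp (M : ModSheaf R) {U V W : C} (f : V ⟶ U) (g : W ⟶ V) (x : M.sec U) :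
    M.res (g ≫ f) x = M.res g (M.res f x) :=
  ConcreteCategory.congr_hom (M.val.presheaf.map_comp f.op g.op) x

theorem ModSheaf.res_smul (M : ModSheaf R) {U V : C} (f : V ⟶ U) (r : ringSec R U)
    (x : M.sec U) : M.res f (r • x) = ringRes R f r • M.res f x :=
  M.val.map_smul f.op r x

/-- Sections that agree on a covering are equal. -/
theorem ModSheaf.ext_of_cover (M : ModSheaf R) {U : C} {S : Sieve U} (hS : S ∈ J U)
    {x y : M.sec U} (h : ∀ (V : C) (f : V ⟶ U), S f → M.res f x = M.res f y) : x = y :=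
  ((((Presheaf.isSheaf_iff_isSheaf_forget J M.val.presheaf (forget Ab)).1 M.isSheaf) |>
    (isSheaf_iff_isSheaf_of_type J _).1) S hS).isSeparatedFor.ext (fun V f hf => h V f hf)

/-- Unique gluing of a family of sections on a covering sieve, for a sheaf of sets. -/
theorem exists_unique_glue {P : Cᵒᵖ ⥤ Type u} (hP : Presieve.IsSheaf J P) {U : C} {S : Sieve U}
    (hS : S ∈ J U) (s : ∀ (V : C) (f : V ⟶ U), S f → P.obj (op V))
    (hs : ∀ (V W : C) (f : V ⟶ U) (g : W ⟶ V) (hf : S f) (hgf : S (g ≫ f)),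
      P.map g.op (s V f hf) = s W (g ≫ f) hgf) :
    ∃! x : P.obj (op U), ∀ (V : C) (f : V ⟶ U) (hf : S f), P.map f.op x = s V f hf := by
  have hc : Presieve.FamilyOfElements.Compatible
      (fun V f hf => s V f hf : Presieve.FamilyOfElements P S.arrows) := by
    refine (Presieve.compatible_iff_sieveCompatible _).2 ?_
    intro V W f g hf
    exact (hs V W f g hf _).symm
  obtain ⟨x, hx, hu⟩ := hP S hS _ hc
  exact ⟨x, fun V f hf => hx f hf, fun z hz => hu z fun V f hf => hz V f hf⟩

theorem ringSec_glue {U : C} {S : Sieve U} (hS : S ∈ J U)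
    (s : ∀ (V : C) (f : V ⟶ U), S f → ringSec R V)
    (hs : ∀ (V W : C) (f : V ⟶ U) (g : W ⟶ V) (hf : S f) (hgf : S (g ≫ f)),
      ringRes R g (s V f hf) = s W (g ≫ f) hgf) :
    ∃! x : ringSec R U, ∀ (V : C) (f : V ⟶ U) (hf : S f), ringRes R f x = s V f hf := by
  have hR := (Presheaf.isSheaf_iff_isSheaf_forget J R.obj (forget CommRingCat)).1 R.property
  rw [isSheaf_iff_isSheaf_of_type] at hR
  exact exists_unique_glue hR hS s hs

theorem ModSheaf.sec_glue (M : ModSheaf R) {U : C} {S : Sieve U} (hS : S ∈ J U)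
    (s : ∀ (V : C) (f : V ⟶ U), S f → M.sec V)
    (hs : ∀ (V W : C) (f : V ⟶ U) (g : W ⟶ V) (hf : S f) (hgf : S (g ≫ f)),
      M.res g (s V f hf) = s W (g ≫ f) hgf) :
    ∃! x : M.sec U, ∀ (V : C) (f : V ⟶ U) (hf : S f), M.res f x = s V f hf := by
  have hM := (Presheaf.isSheaf_iff_isSheaf_forget J M.val.presheaf (forget Ab)).1 M.isSheaf
  rw [isSheaf_iff_isSheaf_of_type] at hM
  exact exists_unique_glue hM hS s hs

/-- The data of modules of sections with restriction maps and unique gluing, from which a sheaf of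
modules is built. -/
structure SectionData (R : Sheaf J CommRingCat.{u}) where
  sec : C → Type u
  [grp : ∀ U, AddCommGroup (sec U)]
  [mod : ∀ U, Module (ringSec R U) (sec U)]
  res : ∀ {U V : C}, (V ⟶ U) → (sec U →+ sec V)
  res_id : ∀ (U : C) (x : sec U), res (𝟙 U) x = x
  res_comp : ∀ {U V W : C} (f : V ⟶ U) (g : W ⟶ V) (x : sec U),
    res (g ≫ f) x = res g (res f x)
  res_smul : ∀ {U V : C} (f : V ⟶ U) (r : ringSec R U) (x : sec U),
    res f (r • x) = ringRes R f r • res f x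
  glue : ∀ (U : C) (S : Sieve U), S ∈ J U → ∀ s : ∀ (V : C) (f : V ⟶ U), S f → sec V,
    (∀ (V W : C) (f : V ⟶ U) (g : W ⟶ V) (hf : S f) (hgf : S (g ≫ f)),
      res g (s V f hf) = s W (g ≫ f) hgf) →
    ∃! x : sec U, ∀ (V : C) (f : V ⟶ U) (hf : S f), res f x = s V f hf

namespace SectionData

attribute [instance] SectionData.grp SectionData.mod

/-- The underlying presheaf of abelian groups. -/
def presheaf (D : SectionData R) : Cᵒᵖ ⥤ Ab.{u} where
  obj U := AddCommGrpCat.of (D.sec U.unop)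
  map f := AddCommGrpCat.ofHom (D.res f.unop)
  map_id U := by
    ext x
    exact D.res_id U.unop x
  map_comp f g := by
    ext x
    exact D.res_comp f.unop g.unop x

instance (D : SectionData R) (U : Cᵒᵖ) : Module
    (((sheafCompose J (forget₂ CommRingCat.{u} RingCat.{u})).obj R).obj.obj U)
    (D.presheaf.obj U) :=
  inferInstanceAs (Module (ringSec R U.unop) (D.sec U.unop))

theorem presheaf_isSheaf (D : SectionData R) : Presheaf.IsSheaf J D.presheaf := by
  refine (Presheaf.isSheaf_iff_isSheaf_forget J D.presheaf (forget Ab)).2 ?_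
  rw [isSheaf_iff_isSheaf_of_type]
  intro U S hS x hx
  obtain ⟨y, hy, hu⟩ := D.glue U S hS (fun V f hf => x f hf) fun V W f g hf hgf => by
    have := hx g (𝟙 W) hf hgf (by simp)
    refine Eq.trans this ?_
    exact D.res_id W _
  exact ⟨y, fun V f hf => hy V f hf, fun z hz => hu z fun V f hf => hz f hf⟩

/-- The sheaf of modules given by the data. -/
noncomputable def toModSheaf (D : SectionData R) : ModSheaf R where
  val := PresheafOfModules.ofPresheaf D.presheaf fun _ _ f r m => D.res_smul f.unop r m
  isSheaf := D.presheaf_isSheaf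

end SectionData

/-- The free module `Rⁿ`, with sections `R(U)ⁿ`. -/
noncomputable def freeMod (R : Sheaf J CommRingCat.{u}) (n : ℕ) : ModSheaf R :=
  SectionData.toModSheaf
    { sec := fun U => Fin n → ringSec R U
      res := fun f => AddMonoidHom.mk' (fun x j => ringRes R f (x j)) fun x y => by
        funext j
        exact map_add (ringRes R f) _ _
      res_id := fun U x => by
        funext j
        exact ringRes_id R (x j)
      res_comp := fun f g x => by
        funext j
        exact ringRes_comp R f g (x j)
      res_smul := fun f r x => by
        funext j
        exact map_mul (ringRes R f) _ _
      glue := fun U S hS s hs => by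
        have key := fun j => ringSec_glue hS (fun V f hf => s V f hf j)
          fun V W f g hf hgf => congrFun (hs V W f g hf hgf) j
        choose y hy hu using key
        refine ⟨y, fun V f hf => ?_, fun z hz => ?_⟩
        · funext j
          exact hy j V f hf
        · funext j
          exact hu j (z j) fun V f hf => congrFun (hz V f hf) j }

/-- An `R`-linear map `M → N` at the stage `U`, i.e. a section over `U` of the internal
`Hom_R(M, N)`: a family of `R(V)`-linear maps `M(V) → N(V)`, one for each `f : V ⟶ U`, compatible
with restriction. -/
@[ext]
structure LinMap (M N : ModSheaf R) (U : C) : Type u where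
  app : ∀ {V : C}, (V ⟶ U) → (M.sec V →ₗ[ringSec R V] N.sec V)
  naturality : ∀ {V W : C} (f : V ⟶ U) (g : W ⟶ V) (x : M.sec V),
    N.res g (app f x) = app (g ≫ f) (M.res g x)

namespace LinMap

variable {M N K : ModSheaf R} {U V : C}

instance : Zero (LinMap M N U) := ⟨⟨fun _ => 0, fun f g x => by simp⟩⟩
instance : Add (LinMap M N U) :=
  ⟨fun φ ψ => ⟨fun f => φ.app f + ψ.app f, fun f g x => by simp [φ.naturality, ψ.naturality]⟩⟩
instance : Neg (LinMap M N U) :=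
  ⟨fun φ => ⟨fun f => -φ.app f, fun f g x => by simp [φ.naturality]⟩⟩
instance : SMul (ringSec R U) (LinMap M N U) :=
  ⟨fun r φ => ⟨fun f => ringRes R f r • φ.app f, fun f g x => by
    simp [ModSheaf.res_smul, φ.naturality, ringRes]⟩⟩

theorem ext' {φ ψ : LinMap M N U}
    (h : ∀ (V : C) (f : V ⟶ U) (x : M.sec V), φ.app f x = ψ.app f x) : φ = ψ := by
  apply LinMap.ext
  funext V f
  exact LinearMap.ext (h V f)

instance : AddCommGroup (LinMap M N U) where
  add_assoc a b c := ext' fun V f x => add_assoc (a.app f x) _ _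
  zero_add a := ext' fun V f x => zero_add (a.app f x)
  add_zero a := ext' fun V f x => add_zero (a.app f x)
  add_comm a b := ext' fun V f x => add_comm (a.app f x) _
  neg_add_cancel a := ext' fun V f x => neg_add_cancel (a.app f x)
  nsmul := nsmulRec
  zsmul := zsmulRec

instance : Module (ringSec R U) (LinMap M N U) where
  one_smul a := ext' fun V f x => by
    change ringRes R f 1 • a.app f x = _
    rw [map_one, one_smul]
  mul_smul r s a := ext' fun V f x => by
    change ringRes R f (r * s) • a.app f x = ringRes R f r • ringRes R f s • a.app f x
    rw [map_mul, mul_smul]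
  smul_zero r := ext' fun V f x => smul_zero (ringRes R f r)
  smul_add r a b := ext' fun V f x => smul_add (ringRes R f r) (a.app f x) (b.app f x)
  add_smul r s a := ext' fun V f x => by
    change ringRes R f (r + s) • a.app f x = ringRes R f r • a.app f x + ringRes R f s • a.app f x
    rw [map_add, add_smul]
  zero_smul a := ext' fun V f x => by
    change ringRes R f 0 • a.app f x = 0
    rw [map_zero, zero_smul]

/-- The restriction of a linear map at the stage `U` along `f : V ⟶ U`. -/
def res (f : V ⟶ U) : LinMap M N U →+ LinMap M N V :=
  AddMonoidHom.mk' (fun φ => ⟨fun g => φ.app (g ≫ f), fun g h x => by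
    rw [φ.naturality, Category.assoc]⟩) fun _ _ => rfl

theorem res_app (f : V ⟶ U) (φ : LinMap M N U) {W : C} (g : W ⟶ V) :
    (res f φ).app g = φ.app (g ≫ f) := rfl

end LinMap

theorem LinMap.glue (M N : ModSheaf R) (U : C) (S : Sieve U) (hS : S ∈ J U)
    (s : ∀ (V : C) (f : V ⟶ U), S f → LinMap M N V)
    (hs : ∀ (V W : C) (f : V ⟶ U) (g : W ⟶ V) (hf : S f) (hgf : S (g ≫ f)),
      LinMap.res g (s V f hf) = s W (g ≫ f) hgf) :
    ∃! φ : LinMap M N U, ∀ (V : C) (f : V ⟶ U) (hf : S f), LinMap.res f φ = s V f hf := by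
  have hs' : ∀ (V W : C) (f : V ⟶ U) (g : W ⟶ V) (hf : S f) (hgf : S (g ≫ f)) (x : M.sec W),
      (s V f hf).app g x = (s W (g ≫ f) hgf).app (𝟙 W) x := fun V W f g hf hgf x => by
    rw [← hs V W f g hf hgf, LinMap.res_app, Category.id_comp]
  have cong : ∀ {W : C} {f g : W ⟶ U} (h : f = g) (hf : S f) (hg : S g) (x : M.sec W),
      (s W f hf).app (𝟙 W) x = (s W g hg).app (𝟙 W) x := by
    rintro W f _ rfl hf hg x
    rfl
  have hk : ∀ (V : C) (f : V ⟶ U) (x : M.sec V), ∃ y : N.sec V, ∀ (W : C) (g : W ⟶ V)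
      (h : S (g ≫ f)), N.res g y = (s W (g ≫ f) h).app (𝟙 W) (M.res g x) := by
    intro V f x
    obtain ⟨y, hy, -⟩ := N.sec_glue (J.pullback_stable f hS)
      (fun W g h => (s W (g ≫ f) h).app (𝟙 W) (M.res g x)) fun W Z g k h hk => by
        have hk' : S (k ≫ g ≫ f) := S.downward_closed h k
        rw [(s W (g ≫ f) h).naturality, Category.comp_id, hs' W Z (g ≫ f) k h hk',
          ← M.res_comp]
        exact cong (Category.assoc k g f).symm _ _ _
    exact ⟨y, hy⟩
  have sep : ∀ (V : C) (f : V ⟶ U) (y z : N.sec V),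
      (∀ (W : C) (g : W ⟶ V), S (g ≫ f) → N.res g y = N.res g z) → y = z := fun V f y z h =>
    N.ext_of_cover (J.pullback_stable f hS) fun W g hg => h W g hg
  choose a ha using hk
  refine ⟨⟨fun {V} f => ⟨⟨a V f, fun x y => ?_⟩, fun r x => ?_⟩, fun {V W} f g x => ?_⟩,
    fun V f hf => LinMap.ext' fun W g x => ?_, fun ψ hψ => LinMap.ext' fun V f x => ?_⟩
  · refine sep V f _ _ fun W g h => ?_
    rw [map_add, ha V f _ W g h, ha V f _ W g h, ha V f _ W g h, map_add, map_add]
  · refine sep V f _ _ fun W g h => ?_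
    rw [ha V f _ W g h, M.res_smul, map_smul, RingHom.id_apply, N.res_smul, ha V f _ W g h]
  · refine sep W (g ≫ f) _ _ fun Z k h => ?_
    have h' : S ((k ≫ g) ≫ f) := by rwa [Category.assoc]
    refine Eq.trans (b := N.res (k ≫ g) (a V f x)) (N.res_comp g k _).symm ?_
    refine Eq.trans (ha V f x Z (k ≫ g) h') ?_
    refine Eq.trans ?_ (ha W (g ≫ f) (M.res g x) Z k h).symm
    rw [M.res_comp]
    exact cong (Category.assoc k g f) _ _ _
  · refine sep W (g ≫ f) _ _ fun Z k h => ?_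
    refine Eq.trans (ha W (g ≫ f) x Z k h) ?_
    rw [(s V f hf).naturality]
    have h' : S ((k ≫ g) ≫ f) := by rwa [Category.assoc]
    rw [hs' V Z f (k ≫ g) hf h']
    exact cong (Category.assoc k g f).symm _ _ _
  · refine sep V f _ _ fun W g h => ?_
    refine Eq.trans ?_ (ha V f x W g h).symm
    rw [ψ.naturality, ← hψ W (g ≫ f) h, LinMap.res_app, Category.id_comp]

/-- The internal `Hom_R(M, N)`, whose sections over `U` are the linear maps `M → N` at the
stage `U`. -/
noncomputable def iHom (M N : ModSheaf R) : ModSheaf R :=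
  SectionData.toModSheaf
    { sec := fun U => LinMap M N U
      res := fun f => LinMap.res f
      res_id := fun U φ => LinMap.ext' fun V f x => by
        rw [LinMap.res_app, Category.comp_id]
      res_comp := fun f g φ => LinMap.ext' fun V h x => by
        rw [LinMap.res_app, LinMap.res_app, LinMap.res_app, Category.assoc]
      res_smul := fun f r φ => LinMap.ext' fun V g x => by
        change ringRes R (g ≫ f) r • φ.app (g ≫ f) x =
          ringRes R g (ringRes R f r) • φ.app (g ≫ f) x
        rw [ringRes_comp]
      glue := LinMap.glue M N }

/-- The base ring `R`, regarded as a module over itself. -/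
noncomputable abbrev baseMod (R : Sheaf J CommRingCat.{u}) : ModSheaf R :=
  SheafOfModules.unit _

/-- The dual module `M^⋆ = Hom_R(M, R)`. -/
noncomputable abbrev dual (M : ModSheaf R) : ModSheaf R := iHom M (baseMod R)

namespace LinMap

variable {M N K : ModSheaf R} {U V : C}

theorem res_id (φ : LinMap M N U) : LinMap.res (𝟙 U) φ = φ :=
  ModSheaf.res_id (iHom M N) φ

/-- Composition of linear maps at the stage `U`. -/
def comp (ψ : LinMap N K U) (φ : LinMap M N U) : LinMap M K U where
  app f := (ψ.app f).comp (φ.app f)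
  naturality f g x := by
    rw [LinearMap.comp_apply, LinearMap.comp_apply, ψ.naturality, φ.naturality]

/-- The dual `φ^⋆ : N^⋆ → M^⋆`, `ξ ↦ ξ ∘ φ`, of a linear map `φ : M → N` at the stage `U`. -/
noncomputable def dualMap (φ : LinMap M N U) : LinMap (dual N) (dual M) U where
  app {V} f :=
    { toFun := fun ξ => LinMap.comp (K := baseMod R) (ξ : LinMap N (baseMod R) V) (LinMap.res f φ)
      map_add' := fun _ _ => rfl
      map_smul' := fun _ _ => rfl }
  naturality {V W} f g ξ := by
    refine LinMap.ext' (N := baseMod R) fun Z h x => ?_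
    change (ξ : LinMap N (baseMod R) V).app (h ≫ g) (φ.app ((h ≫ g) ≫ f) x) =
      (ξ : LinMap N (baseMod R) V).app (h ≫ g) (φ.app (h ≫ g ≫ f) x)
    rw [Category.assoc]

/-- The canonical linear map `M → M^⋆⋆`, `x ↦ (ξ ↦ ξ(x))`, at the stage `U`. -/
noncomputable def toDoubleDual (M : ModSheaf R) (U : C) : LinMap M (dual (dual M)) U where
  app {V} _ :=
    { toFun := fun x =>
        ({ app := fun {W} g =>
            { toFun := fun ξ => (ξ : LinMap M (baseMod R) W).app (𝟙 W) (M.res g x)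
              map_add' := fun _ _ => rfl
              map_smul' := fun r ξ => by
                change ringRes R (𝟙 W) r • (ξ : LinMap M (baseMod R) W).app (𝟙 W) (M.res g x) =
                  r • (ξ : LinMap M (baseMod R) W).app (𝟙 W) (M.res g x)
                rw [ringRes_id] }
           naturality := fun {W Z} g h ξ => by
            change (baseMod R).res h ((ξ : LinMap M (baseMod R) W).app (𝟙 W) (M.res g x)) =
              (ξ : LinMap M (baseMod R) W).app (𝟙 Z ≫ h) (M.res (h ≫ g) x)
            rw [(ξ : LinMap M (baseMod R) W).naturality, Category.comp_id, Category.id_comp,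
              M.res_comp] } : LinMap (dual M) (baseMod R) V)
      map_add' := fun x y => LinMap.ext' (M := dual M) (N := baseMod R) fun W g ξ => by
        change (ξ : LinMap M (baseMod R) W).app (𝟙 W) (M.res g (x + y)) =
          (ξ : LinMap M (baseMod R) W).app (𝟙 W) (M.res g x) +
            (ξ : LinMap M (baseMod R) W).app (𝟙 W) (M.res g y)
        rw [map_add, map_add]
      map_smul' := fun r x => LinMap.ext' (M := dual M) (N := baseMod R) fun W g ξ => by
        change (ξ : LinMap M (baseMod R) W).app (𝟙 W) (M.res g (r • x)) =
          ringRes R g r • (ξ : LinMap M (baseMod R) W).app (𝟙 W) (M.res g x)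
        rw [M.res_smul, map_smul] }
  naturality {V W} f g x := LinMap.ext' (M := dual M) (N := baseMod R) fun Z k ξ => by
    change (ξ : LinMap M (baseMod R) Z).app (𝟙 Z) (M.res (k ≫ g) x) =
      (ξ : LinMap M (baseMod R) Z).app (𝟙 Z) (M.res k (M.res g x))
    rw [M.res_comp]

/-- `φ` is injective at the stage `U`. -/
def IsInjective (φ : LinMap M N U) : Prop :=
  ∀ (V : C) (f : V ⟶ U) (x : M.sec V), φ.app f x = 0 → x = 0

/-- `φ` is surjective at the stage `U`: every element of `N` over `V ⟶ U` locally has a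
preimage. -/
def IsSurjective (φ : LinMap M N U) : Prop :=
  ∀ (V : C) (f : V ⟶ U) (y : N.sec V), ∃ S ∈ J V, ∀ (W : C) (g : W ⟶ V), S g →
    ∃ x : M.sec W, φ.app (g ≫ f) x = N.res g y

/-- `M → N → K` is exact at `N` at the stage `U`: an element `y` of `N` over `V ⟶ U` is
annihilated by `ψ` if and only if it locally has a preimage under `φ`. -/
def IsExact (φ : LinMap M N U) (ψ : LinMap N K U) : Prop :=
  ∀ (V : C) (f : V ⟶ U) (y : N.sec V), ψ.app f y = 0 ↔
    ∃ S ∈ J V, ∀ (W : C) (g : W ⟶ V), S g → ∃ x : M.sec W, φ.app (g ≫ f) x = N.res g y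

/-- `φ` is an isomorphism of modules over `U`. -/
def IsIsomorphism (φ : LinMap M N U) : Prop :=
  ∀ (V : C) (f : V ⟶ U), Function.Bijective (φ.app f)

end LinMap

/-- `M` is finitely presented at the stage `U`: locally there is an exact sequence
`R^m → R^n → M → 0`. -/
def IsFinPresented (M : ModSheaf R) (U : C) : Prop :=
  ∃ S ∈ J U, ∀ (V : C) (f : V ⟶ U), S f →
    ∃ (n m : ℕ) (ρ : LinMap (freeMod R m) (freeMod R n) V) (π : LinMap (freeMod R n) M V),
      LinMap.IsExact ρ π ∧ LinMap.IsSurjective π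

/-- `M` is finitely copresented at the stage `U`: locally there is an exact sequence
`0 → M → R^n → R^m`. -/
def IsFinCopresented (M : ModSheaf R) (U : C) : Prop :=
  ∃ S ∈ J U, ∀ (V : C) (f : V ⟶ U), S f →
    ∃ (n m : ℕ) (φ : LinMap M (freeMod R n) V) (P : LinMap (freeMod R n) (freeMod R m) V),
      LinMap.IsInjective φ ∧ LinMap.IsExact φ P

end Modules

/-! ### Degree-one coefficients of polynomials -/

section LinearParts

open MvPolynomial

/-! The kernel of `P : Rⁿ → Rᵐ` is `Spec A` for `A = R[X₁,…,Xₙ]` modulo the linear forms given by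
the rows of `P`, so the duality axiom applies to it. A functional on `M ≅ ker P` is a function on
`Spec A`, hence locally a polynomial `F`. Homogeneity gives `F(Tx) = T F(x)`, first for all values
of `T` and then, by the axiom for `R[T]`, coefficientwise; the coefficient of `T` says that `F(x)`
is the value at `x` of the linear part of `F`. So the functional locally extends to `Rⁿ`
(`exists_linearForm`, `exists_extension`), and `φ^⋆` is surjective. A functional on `Rⁿ` vanishing
on `ker P` is a linear polynomial vanishing on `Spec A`, so it locally lies in the ideal of the row
forms; comparing linear coefficients makes it a linear combination of rows, i.e. it factors through
`P` (`exists_rowCombination`, `exists_factorization`). This is exactness in the middle, and `Rⁿ ≅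
(Rⁿ)^⋆` turns the dual sequence into a presentation. For copresented `M`, a section of `M^⋆⋆` is
pushed to `(Rⁿ)^⋆⋆`, where it is evaluation at some `y`; `P` kills `y`, so `y` comes from `M`, and
surjectivity of `φ^⋆` shows that the section is evaluation there. For presented `M`, dualising gives
a copresentation of `M^⋆`; dualising that by the first statement exhibits `M^⋆⋆` as the cokernel of
the original `ρ`, just like `M`. -/

theorem coeff_single_one_bind₁_scale {K : Type*} [CommRing K] {n : ℕ} (x : Fin n → K)
    (F : MvPolynomial (Fin n) K) :
    coeff (Finsupp.single 0 1) (bind₁ (fun j => C (x j) * X (0 : Fin 1)) F) =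
      ∑ j, coeff (Finsupp.single j 1) F * x j := by
  induction F using MvPolynomial.induction_on' with
  | add p q hp hq => simp [hp, hq, add_mul, Finset.sum_add_distrib]
  | monomial d r =>
    -- Substituting `Tx` turns a monomial into its value at `x` times `T` to its total degree, so
    -- only monomials of degree one contribute.
    have h1 : bind₁ (fun j => C (x j) * X (0 : Fin 1)) (monomial d r) =
        C (r * ∏ j, x j ^ d j) * X 0 ^ d.degree := by
      rw [bind₁_monomial, Finset.prod_subset (Finset.subset_univ d.support) (by simp +contextual),
        Finsupp.degree_eq_sum]
      simp [mul_pow, Finset.prod_mul_distrib, Finset.prod_pow_eq_pow_sum, mul_assoc]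
    rw [h1, coeff_C_mul, coeff_X_pow]
    by_cases hd : d.degree = 1
    · obtain ⟨i, rfl⟩ := (Finsupp.sum_eq_one_iff d).1 hd
      have h2 : ∏ j, x j ^ (Finsupp.single i 1 : Fin n →₀ ℕ) j = x i := by
        rw [Finset.prod_eq_single i] <;> simp +contextual [eq_comm]
      rw [h2, Finset.sum_eq_single i]
      · simp
      · intro j _ hj
        rw [coeff_monomial, if_neg, zero_mul]
        exact fun h => hj ((Finsupp.single_left_inj one_ne_zero).1 h).symm
      · simp
    · rw [if_neg, mul_zero, Finset.sum_eq_zero]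
      · intro j _
        rw [coeff_monomial, if_neg, zero_mul]
        rintro rfl
        simp at hd
      · intro h
        exact hd (by simpa using DFunLike.congr_fun h 0)

/-- A linear form has no constant term, so only the constant term of the other factor reaches degree
one. This converts ideal membership into a combination with scalar coefficients. -/
theorem coeff_single_one_mul_linearForm {K : Type*} [CommRing K] {n : ℕ} (p : Fin n → K)
    (g : MvPolynomial (Fin n) K) (j : Fin n) :
    coeff (Finsupp.single j 1) (g * ∑ k, C (p k) * X k) = coeff 0 g * p j := by
  rw [Finset.mul_sum, coeff_sum, Finset.sum_eq_single j]
  · rw [mul_left_comm, coeff_C_mul, coeff_mul_X']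
    simp [mul_comm]
  · intro k _ hk
    rw [mul_left_comm, coeff_C_mul, coeff_mul_X', if_neg, mul_zero]
    simpa [Finsupp.single_apply] using hk
  · simp

end LinearParts

/-! ### Linear consequences of the duality axiom -/

section LinearForms

variable {C : Type u} [Category.{v} C] {J : GrothendieckTopology C}

open MvPolynomial

/-- The linear polynomials whose coefficients are the rows of a matrix. -/
noncomputable def rowForms {K : Type*} [CommRing K] {m n : ℕ} (P : Fin m → Fin n → K) (i : Fin m) :
    MvPolynomial (Fin n) K :=
  ∑ j, MvPolynomial.C (P i j) * X j

theorem eval_map_rowForms {K L : Type*} [CommRing K] [CommRing L] {m n : ℕ} (P : Fin m → Fin n → K)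
    (h : K →+* L) (x : Fin n → L) (i : Fin m) :
    eval x (map h (rowForms P i)) = ∑ j, h (P i j) * x j := by
  simp [rowForms]

theorem ringSec_ext_of_cover (R : Sheaf J CommRingCat.{max u v}) {U : C} {S : Sieve U}
    (hS : S ∈ J U) {x y : ringSec R U}
    (h : ∀ (V : C) (f : V ⟶ U), S f → ringRes R f x = ringRes R f y) : x = y := by
  have hR := (Presheaf.isSheaf_iff_isSheaf_forget J R.obj (forget CommRingCat)).1 R.property
  rw [isSheaf_iff_isSheaf_of_type] at hR
  exact (hR S hS).isSeparatedFor.ext fun V f hf => h V f hf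

variable {R : Sheaf J CommRingCat.{max u v}}

theorem SatisfiesDuality.exists_rowCombination (hR : SatisfiesDuality R) {U : C} {m n : ℕ}
    (P : Fin m → Fin n → ringSec R U) (a : Fin n → ringSec R U)
    (h : ∀ (V : C) (f : V ⟶ U) (x : Fin n → ringSec R V),
      (∀ i, ∑ j, ringRes R f (P i j) * x j = 0) → ∑ j, ringRes R f (a j) * x j = 0) :
    ∃ S ∈ J U, ∀ (V : C) (f : V ⟶ U), S f → ∃ c : Fin m → ringSec R V,
      ∀ j, ringRes R f (a j) = ∑ i, c i * ringRes R f (P i j) := by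
  obtain ⟨S, hS, hF⟩ := hR.injective U n m (rowForms P) (rowForms (fun _ : Fin 1 => a) 0)
    fun V f x => by
      rw [eval_map_rowForms]
      exact h V f x.1 fun i => by rw [← eval_map_rowForms]; exact x.2 i
  refine ⟨S, hS, fun V f hf => ?_⟩
  obtain ⟨g, hg⟩ := (Ideal.mem_span_range_iff_exists_fun).1 (hF V f hf)
  -- Comparing linear coefficients in `a = ∑ gᵢ Pᵢ` leaves only the constant terms of the `gᵢ`.
  refine ⟨fun i => coeff 0 (g i), fun j => ?_⟩
  have hm : ∀ {k : ℕ} (Q : Fin k → Fin n → ringSec R U) (i : Fin k),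
      map (ringRes R f) (rowForms Q i) = ∑ j, MvPolynomial.C (ringRes R f (Q i j)) * X j := by
    intro k Q i
    simp [rowForms]
  have := congrArg (coeff (Finsupp.single j 1)) hg
  rw [coeff_sum] at this
  simp only [hm, coeff_single_one_mul_linearForm] at this
  rw [this, ← one_mul (∑ j, _), coeff_single_one_mul_linearForm]
  simp

/-- With `x` fixed, `F(Tx) - F(x) T` is a polynomial in one variable that vanishes on the whole
affine line. The axiom with one variable and no relations makes it zero on a covering, and its
coefficient at `T` is the claim. -/
theorem eval_eq_linearPart_of_homogeneous (hR : SatisfiesDuality R) {U : C} {n : ℕ}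
    (F : MvPolynomial (Fin n) (ringSec R U)) (x : Fin n → ringSec R U)
    (h : ∀ (V : C) (f : V ⟶ U) (r : ringSec R V),
      eval (fun j => r * ringRes R f (x j)) (map (ringRes R f) F) =
        r * ringRes R f (eval x F)) :
    eval x F = ∑ j, coeff (Finsupp.single j 1) F * x j := by
  obtain ⟨S, hS, hF⟩ := hR.injective U 1 0 Fin.elim0
    (bind₁ (fun j => MvPolynomial.C (x j) * X (0 : Fin 1)) F - MvPolynomial.C (eval x F) * X 0) fun V f r => by
      have := h V f (r.1 0)
      simp only [map_sub, map_mul, map_C, map_X, eval_C, eval_X, map_bind₁]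
      rw [mul_comm (ringRes R f (eval x F)), ← this, sub_eq_zero, ← aeval_eq_eval, aeval_bind₁, ← aeval_eq_eval]
      simp [mul_comm]
  refine (ringSec_ext_of_cover R hS fun V f hf => ?_).symm
  have := hF V f hf
  rw [relIdeal, Set.range_eq_empty, Ideal.span_empty, Ideal.mem_bot] at this
  have h2 := congrArg (coeff (Finsupp.single 0 1)) this
  rw [coeff_map, coeff_sub, coeff_single_one_bind₁_scale, coeff_C_mul, coeff_zero, map_sub,
    sub_eq_zero] at h2
  simpa using h2

/-- Homogeneity of degree one suffices: the linear part of a representing polynomial has the same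
values at every point, and its coefficients do not depend on the point. -/
theorem SatisfiesDuality.exists_linearForm (hR : SatisfiesDuality R) {U : C} {m n : ℕ}
    (P : Fin m → Fin n → ringSec R U) (s : SpecFun R (rowForms P))
    (h : ∀ (V : C) (f : V ⟶ U) (r : ringSec R V) (x y : SpecPoints R (rowForms P) f),
      (∀ j, y.1 j = r * x.1 j) → s.app f y = r * s.app f x) :
    ∃ S ∈ J U, ∀ (V : C) (f : V ⟶ U), S f → ∃ a : Fin n → ringSec R V,
      ∀ (W : C) (g : W ⟶ V) (x : SpecPoints R (rowForms P) (g ≫ f)),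
        s.app (g ≫ f) x = ∑ j, ringRes R g (a j) * x.1 j := by
  obtain ⟨S, hS, hF⟩ := hR.surjective U n m _ s
  refine ⟨S, hS, fun V f hf => ?_⟩
  obtain ⟨F, hF⟩ := hF V f hf
  refine ⟨fun j => coeff (Finsupp.single j 1) F, fun W g x => ?_⟩
  simp only [← coeff_map]
  rw [hF]
  refine eval_eq_linearPart_of_homogeneous hR _ _ fun Z k r => ?_
  have e : k ≫ g ≫ f = (k ≫ g) ≫ f := (Category.assoc _ _ _).symm
  have hk : ringRes R (k ≫ g) = (ringRes R k).comp (ringRes R g) :=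
    RingHom.ext fun r => ringRes_comp R g k r
  -- The zero locus of linear forms is closed under scaling, so `F` represents the function at `r x`
  -- as well as at `x`.
  have hy : ∀ i, eval (fun j => r * ringRes R k (x.1 j))
      (map (ringRes R ((k ≫ g) ≫ f)) (rowForms P i)) = 0 := by
    intro i
    have h2 := (x.res k).2 i
    rw [eval_map_rowForms] at h2 ⊢
    rw [← e]
    simp only [mul_left_comm _ r, ← Finset.mul_sum]
    exact (congrArg (r * ·) h2).trans (mul_zero r)
  have hx : ∀ i, eval (fun j => ringRes R k (x.1 j))
      (map (ringRes R ((k ≫ g) ≫ f)) (rowForms P i)) = 0 := by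
    intro i
    rw [← e]
    exact (x.res k).2 i
  have h1 := hF Z (k ≫ g) ⟨_, hy⟩
  have h2 := hF Z (k ≫ g) ⟨_, hx⟩
  have h3 := h Z ((k ≫ g) ≫ f) r ⟨_, hx⟩ ⟨_, hy⟩ fun j => rfl
  rw [h1, h2, hk, ← map_map] at h3
  refine h3.trans ?_
  congr 1
  exact (MvPolynomial.eval_map _ _ _).trans (eval₂_comp_left (ringRes R k) (RingHom.id _) x.1 _).symm

end LinearForms

/-! ### Free modules, gluing and descent, duals in coordinates -/

section DualModules

variable {C : Type u} [SmallCategory C] {J : GrothendieckTopology C} {R : Sheaf J CommRingCat.{u}}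

/-- The `j`-th coordinate of a section of `Rⁿ`. -/
noncomputable def freeCoord {n : ℕ} {U : C} (j : Fin n) :
    (freeMod R n).sec U →ₗ[ringSec R U] ringSec R U where
  toFun x := (show Fin n → ringSec R U from x) j
  map_add' _ _ := rfl
  map_smul' _ _ := rfl

/-- The section of `Rⁿ` with given coordinates. -/
noncomputable def freeMk {n : ℕ} {U : C} (x : Fin n → ringSec R U) : (freeMod R n).sec U := x

@[simp]
theorem freeCoord_freeMk {n : ℕ} {U : C} (x : Fin n → ringSec R U) (j : Fin n) :
    freeCoord j (freeMk x) = x j := rfl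

theorem freeMod_ext {n : ℕ} {U : C} {x y : (freeMod R n).sec U}
    (h : ∀ j, freeCoord j x = freeCoord j y) : x = y :=
  funext (f := (show Fin n → ringSec R U from x)) h

@[simp]
theorem freeCoord_res {n : ℕ} {U V : C} (f : V ⟶ U) (x : (freeMod R n).sec U) (j : Fin n) :
    freeCoord j ((freeMod R n).res f x) = ringRes R f (freeCoord j x) := rfl

/-- The `j`-th basis vector of `Rⁿ`. -/
noncomputable def freeBasis (R : Sheaf J CommRingCat.{u}) {n : ℕ} (U : C) (j : Fin n) :
    (freeMod R n).sec U :=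
  freeMk (Pi.single j 1)

theorem freeCoord_freeBasis {n : ℕ} {U : C} (i j : Fin n) :
    freeCoord i (freeBasis R U j) = if i = j then 1 else 0 :=
  Pi.single_apply j 1 i

theorem freeMod_res_freeBasis {n : ℕ} {U V : C} (f : V ⟶ U) (j : Fin n) :
    (freeMod R n).res f (freeBasis R U j) = freeBasis R V j :=
  freeMod_ext fun i => by
    rw [freeCoord_res, freeCoord_freeBasis, freeCoord_freeBasis, apply_ite (ringRes R f), map_one,
      map_zero]

theorem sum_freeCoord_smul_freeBasis {n : ℕ} {U : C} (x : (freeMod R n).sec U) :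
    ∑ j, freeCoord j x • freeBasis R U j = x :=
  freeMod_ext fun i => by
    simp [freeCoord_freeBasis]

variable {M N K : ModSheaf R} {U V W : C}

theorem LinMap.app_free {n : ℕ} (L : LinMap (freeMod R n) N U) (f : V ⟶ U)
    (x : (freeMod R n).sec V) :
    L.app f x = ∑ j, freeCoord j x • N.res f (L.app (𝟙 U) (freeBasis R U j)) := by
  conv_lhs => rw [← sum_freeCoord_smul_freeBasis x]
  simp only [map_sum, map_smul, L.naturality, Category.comp_id, freeMod_res_freeBasis]

/-- The linear map `Rⁿ → N` with given values on the basis vectors. -/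
noncomputable def LinMap.freeLift {n : ℕ} (y : Fin n → N.sec U) : LinMap (freeMod R n) N U where
  app f :=
    { toFun := fun x => ∑ j, freeCoord j x • N.res f (y j)
      map_add' := fun x x' => by simp [add_smul, Finset.sum_add_distrib]
      map_smul' := fun r x => by simp [mul_smul, Finset.smul_sum] }
  naturality f g x := by
    simp [N.res_smul, N.res_comp]

/-- The value `ξ(x)` of a section `ξ` of the dual module. -/
noncomputable def dualApp (ξ : (dual M).sec V) (g : W ⟶ V) :
    M.sec W →ₗ[ringSec R W] (baseMod R).sec W :=
  (show LinMap M (baseMod R) V from ξ).app g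

theorem dual_ext {ξ η : (dual M).sec V}
    (h : ∀ (W : C) (g : W ⟶ V) (x : M.sec W), dualApp ξ g x = dualApp η g x) : ξ = η :=
  LinMap.ext' (M := M) (N := baseMod R) (U := V) h

@[simp]
theorem dualApp_res (f : V ⟶ U) (ξ : (dual M).sec U) (g : W ⟶ V) :
    dualApp ((dual M).res f ξ) g = dualApp ξ (g ≫ f) := rfl

@[simp]
theorem dualApp_zero (g : W ⟶ V) : dualApp (0 : (dual M).sec V) g = 0 := rfl

theorem res_dualApp (ξ : (dual M).sec U) (f : V ⟶ U) (g : W ⟶ V) (x : M.sec V) :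
    (baseMod R).res g (dualApp ξ f x) = dualApp ξ (g ≫ f) (M.res g x) :=
  (show LinMap M (baseMod R) U from ξ).naturality f g x

@[simp]
theorem dualApp_dualMap (φ : LinMap M N U) (f : V ⟶ U) (ξ : (dual N).sec V) (g : W ⟶ V)
    (x : M.sec W) : dualApp (φ.dualMap.app f ξ) g x = dualApp ξ g (φ.app (g ≫ f) x) := rfl

@[simp]
theorem dualApp_toDoubleDual (f : V ⟶ U) (x : M.sec V) (g : W ⟶ V) (ξ : (dual M).sec W) :
    dualApp ((LinMap.toDoubleDual M U).app f x) g ξ = dualApp ξ (𝟙 W) (M.res g x) := rfl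

namespace LinMap

theorem IsInjective.app_injective {φ : LinMap M N U} (hφ : φ.IsInjective) (f : V ⟶ U) :
    Function.Injective (φ.app f) :=
  (injective_iff_map_eq_zero _).2 (hφ V f)

/-- Preimages under an injective map are unique, so local ones are compatible and glue. -/
theorem IsInjective.exists_app_eq {φ : LinMap M N U} (hφ : φ.IsInjective) (f : V ⟶ U)
    {y : N.sec V} (h : ∃ S ∈ J V, ∀ (W : C) (g : W ⟶ V), S g →
      ∃ x : M.sec W, φ.app (g ≫ f) x = N.res g y) : ∃ x, φ.app f x = y := by
  obtain ⟨S, hS, h⟩ := h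
  choose s hs using h
  obtain ⟨x, hx, -⟩ := M.sec_glue hS s fun W Z g k hg hkg => by
    apply hφ.app_injective ((k ≫ g) ≫ f)
    rw [hs Z (k ≫ g) hkg, N.res_comp, ← hs W g hg, φ.naturality, Category.assoc]
  refine ⟨x, N.ext_of_cover hS fun W g hg => ?_⟩
  rw [φ.naturality, hx W g hg, hs W g hg]

theorem IsIsomorphism.of_injective_of_surjective {φ : LinMap M N U} (hφ : φ.IsInjective)
    (hφ' : φ.IsSurjective) : φ.IsIsomorphism := fun V f =>
  ⟨hφ.app_injective f, fun y => hφ.exists_app_eq f (hφ' V f y)⟩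

theorem IsIsomorphism.of_cover {φ : LinMap M N U}
    (h : ∃ S ∈ J U, ∀ (V : C) (f : V ⟶ U), S f → (LinMap.res f φ).IsIsomorphism) :
    φ.IsIsomorphism := by
  obtain ⟨S, hS, h⟩ := h
  have h' : ∀ {V W : C} (f : V ⟶ U) (g : W ⟶ V), S (g ≫ f) →
      Function.Bijective (φ.app (g ≫ f)) := fun {_ W} f g hg => by
    have := h W (g ≫ f) hg W (𝟙 W)
    rwa [res_app, Category.id_comp] at this
  refine of_injective_of_surjective (fun V f x hx => ?_) fun V f y => ?_
  · refine M.ext_of_cover (J.pullback_stable f hS) fun W g hg => (h' f g hg).1 ?_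
    rw [← φ.naturality, hx, map_zero, map_zero, map_zero]
  · exact ⟨S.pullback f, J.pullback_stable f hS, fun W g hg => (h' f g hg).2 _⟩

theorem IsExact.app_app {φ : LinMap M N U} {ψ : LinMap N K U} (h : IsExact φ ψ) (f : V ⟶ U)
    (x : M.sec V) : ψ.app f (φ.app f x) = 0 :=
  (h V f _).2 ⟨⊤, J.top_mem V, fun _ g _ => ⟨M.res g x, (φ.naturality f g x).symm⟩⟩

theorem IsInjective.res {φ : LinMap M N U} (hφ : φ.IsInjective) (f : V ⟶ U) :
    (LinMap.res f φ).IsInjective := fun W g x hx => hφ W (g ≫ f) x hx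

theorem IsExact.res {φ : LinMap M N U} {ψ : LinMap N K U} (h : IsExact φ ψ) (f : V ⟶ U) :
    IsExact (LinMap.res f φ) (LinMap.res f ψ) := fun W g y => by
  refine (h W (g ≫ f) y).trans ?_
  simp only [res_app, Category.assoc]

theorem IsExact.exists_app_eq {φ : LinMap M N U} {ψ : LinMap N K U} (h : IsExact φ ψ)
    (hφ : φ.IsInjective) (f : V ⟶ U) {y : N.sec V} (hy : ψ.app f y = 0) : ∃ x, φ.app f x = y :=
  hφ.exists_app_eq f ((h V f y).1 hy)

end LinMap

/-- The isomorphism `Rⁿ → (Rⁿ)^⋆`, `a ↦ (x ↦ ∑ aⱼ xⱼ)`. -/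
noncomputable def freeToDual (R : Sheaf J CommRingCat.{u}) (n : ℕ) (U : C) :
    LinMap (freeMod R n) (dual (freeMod R n)) U where
  app {V} _ :=
    { toFun := fun a => LinMap.freeLift (N := baseMod R) (U := V) fun j => freeCoord j a
      map_add' := fun a b => dual_ext fun W g x => by
        change ∑ j, freeCoord j x * ringRes R g (freeCoord j (a + b)) =
          (show ringSec R W from (∑ j, freeCoord j x * ringRes R g (freeCoord j a))) +
          (show ringSec R W from (∑ j, freeCoord j x * ringRes R g (freeCoord j b)))
        simp [mul_add, Finset.sum_add_distrib]
      map_smul' := fun r a => dual_ext fun W g x => by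
        change ∑ j, freeCoord j x * ringRes R g (freeCoord j (r • a)) =
          (show ringSec R W from
            ringRes R g r * (∑ j, freeCoord j x * ringRes R g (freeCoord j a)))
        simp [Finset.mul_sum, mul_left_comm] }
  naturality {V W} f g a := dual_ext fun Z h x => by
    change ∑ j, freeCoord j x * ringRes R (h ≫ g) (freeCoord j a) =
      ∑ j, freeCoord j x * ringRes R h (freeCoord j ((freeMod R n).res g a))
    simp only [freeCoord_res, ringRes_comp]

theorem dualApp_freeToDual {n : ℕ} (f : V ⟶ U) (a : (freeMod R n).sec V) (g : W ⟶ V)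
    (x : (freeMod R n).sec W) :
    dualApp ((freeToDual R n U).app f a) g x =
      (show ringSec R W from ∑ j, freeCoord j x * ringRes R g (freeCoord j a)) := rfl

/-- Symmetry of the pairing `∑ aⱼ xⱼ`: functional and argument may trade places, which is how `Rⁿ ≅
(Rⁿ)^⋆⋆` enters below. -/
theorem dualApp_freeToDual_comm {n : ℕ} (f : V ⟶ U) (f' : W ⟶ U) (a : (freeMod R n).sec V)
    (g : W ⟶ V) (x : (freeMod R n).sec W) :
    dualApp ((freeToDual R n U).app f a) g x =
      dualApp ((freeToDual R n U).app f' x) (𝟙 W) ((freeMod R n).res g a) := by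
  rw [dualApp_freeToDual, dualApp_freeToDual]
  refine Finset.sum_congr rfl fun j _ => ?_
  rw [freeCoord_res, ringRes_id, mul_comm]

/-- The map `N^⋆ → Rⁿ` of evaluation at given sections of `N`. -/
noncomputable def evalTuple {n : ℕ} (y : Fin n → N.sec U) : LinMap (dual N) (freeMod R n) U where
  app {V} f :=
    { toFun := fun ξ => freeMk fun j => dualApp ξ (𝟙 V) (N.res f (y j))
      map_add' := fun _ _ => rfl
      map_smul' := fun r ξ => freeMod_ext fun j => by
        change ringRes R (𝟙 V) r * _ = r * _
        rw [ringRes_id]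
        rfl }
  naturality {V W} f g ξ := freeMod_ext fun j => by
    change (baseMod R).res g (dualApp ξ (𝟙 V) (N.res f (y j))) =
      dualApp ξ (𝟙 W ≫ g) (N.res (g ≫ f) (y j))
    rw [res_dualApp, N.res_comp, Category.comp_id, Category.id_comp]

/-- The coordinates of `ξ ∘ L` are its values on the basis, so evaluation at the images of the basis
is `L^⋆` read through `(Rⁿ)^⋆ ≅ Rⁿ`. -/
theorem freeToDual_evalTuple {n : ℕ} (L : LinMap (freeMod R n) N U) (f : V ⟶ U)
    (ξ : (dual N).sec V) :
    (freeToDual R n U).app f ((evalTuple fun j => L.app (𝟙 U) (freeBasis R U j)).app f ξ) =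
      L.dualMap.app f ξ := by
  refine dual_ext fun W g x => ?_
  rw [dualApp_dualMap, L.app_free, map_sum, dualApp_freeToDual]
  refine Finset.sum_congr rfl fun j _ => ?_
  have h := res_dualApp ξ (𝟙 V) g (N.res f (L.app (𝟙 U) (freeBasis R U j)))
  rw [Category.comp_id, ← N.res_comp] at h
  rw [map_smul, ← h]
  rfl

theorem freeToDual_injective (n : ℕ) (U : C) : (freeToDual R n U).IsInjective := by
  intro V f a ha
  refine freeMod_ext fun j => ?_
  have := LinearMap.congr_fun (congrArg (fun ξ => dualApp ξ (𝟙 V)) ha) (freeBasis R V j)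
  have h : ∑ i, freeCoord i (freeBasis R V j) * ringRes R (𝟙 V) (freeCoord i a) = 0 := this
  simpa [freeCoord_freeBasis, ringRes_id] using h

theorem freeToDual_surjective (n : ℕ) (f : V ⟶ U) :
    Function.Surjective ((freeToDual R n U).app f) := fun ξ =>
  ⟨(evalTuple (freeBasis R U)).app f ξ, by
    -- For `L` the identity, this says that evaluation on the basis is a right inverse.
    have h := freeToDual_evalTuple (⟨fun _ => LinearMap.id, fun _ _ _ => rfl⟩ :
      LinMap (freeMod R n) (freeMod R n) U) f ξ
    exact h⟩

/-- Naturality of `N → N^⋆⋆` along `L`, in coordinates. For a presentation `L = π` it compares `M`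
and `M^⋆⋆` as quotients of `Rⁿ`. -/
theorem evalTuple_dualMap_freeToDual {n : ℕ} (L : LinMap (freeMod R n) N U) (f : V ⟶ U)
    (y : (freeMod R n).sec V) :
    (evalTuple fun j => L.app (𝟙 U) (freeBasis R U j)).dualMap.app f
        ((freeToDual R n U).app f y) = (LinMap.toDoubleDual N U).app f (L.app f y) := by
  refine dual_ext fun W g ξ => ?_
  rw [dualApp_dualMap, dualApp_freeToDual_comm f (g ≫ f), freeToDual_evalTuple, dualApp_dualMap,
    dualApp_toDoubleDual, L.naturality, Category.id_comp]

/-- A functional that vanishes on the kernel of a surjective map descends along it. -/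
theorem LinMap.IsSurjective.exists_descent {π : LinMap N M U} (hπ : π.IsSurjective)
    (η : (dual N).sec U)
    (h : ∀ (V : C) (f : V ⟶ U) (y : N.sec V), π.app f y = 0 → dualApp η f y = 0) :
    ∃ ξ : (dual M).sec U, ∀ (V : C) (f : V ⟶ U) (y : N.sec V),
      dualApp ξ f (π.app f y) = dualApp η f y := by
  have hwd : ∀ {V : C} (f : V ⟶ U) (y z : N.sec V), π.app f y = π.app f z →
      dualApp η f y = dualApp η f z := fun f y z hyz => by
    rw [← sub_eq_zero, ← map_sub]
    exact h _ f _ (by rw [map_sub, hyz, sub_self])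
  -- The value at `x` is glued from `η` on local preimages. Characterising it by all preimages at
  -- all later stages makes it independent of the choices.
  have key : ∀ {V : C} (f : V ⟶ U) (x : M.sec V), ∃ s : (baseMod R).sec V,
      ∀ (W : C) (g : W ⟶ V) (y : N.sec W), π.app (g ≫ f) y = M.res g x →
        (baseMod R).res g s = dualApp η (g ≫ f) y := by
    intro V f x
    obtain ⟨S, hS, hs⟩ := hπ V f x
    choose y hy using hs
    obtain ⟨s, hs, -⟩ := (baseMod R).sec_glue hS (fun W g hg => dualApp η (g ≫ f) (y W g hg))
      fun W Z g k hg hkg => by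
        rw [res_dualApp, ← Category.assoc]
        refine hwd _ _ _ ?_
        rw [hy Z (k ≫ g) hkg, M.res_comp, ← hy W g hg, π.naturality, Category.assoc]
    refine ⟨s, fun W g z hz => (baseMod R).ext_of_cover (J.pullback_stable g hS) fun Z k hk => ?_⟩
    rw [← ModSheaf.res_comp, hs Z (k ≫ g) hk, res_dualApp, ← Category.assoc]
    refine hwd _ _ _ ?_
    rw [hy Z (k ≫ g) hk, M.res_comp, ← hz, π.naturality, Category.assoc]
  choose s hs using @key
  have hres : ∀ {V W : C} (f : V ⟶ U) (g : W ⟶ V) (x : M.sec V),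
      (baseMod R).res g (s f x) = s (g ≫ f) (M.res g x) := by
    intro V W f g x
    obtain ⟨S, hS, hy⟩ := hπ W (g ≫ f) (M.res g x)
    refine (baseMod R).ext_of_cover hS fun Z k hk => ?_
    obtain ⟨y, hy⟩ := hy Z k hk
    rw [hs (g ≫ f) (M.res g x) Z k y hy, ← ModSheaf.res_comp, ← Category.assoc]
    exact hs f x Z (k ≫ g) y (by rw [Category.assoc, hy, M.res_comp])
  have happ : ∀ {V : C} (f : V ⟶ U) (y : N.sec V), s f (π.app f y) = dualApp η f y := by
    intro V f y
    have := hs f (π.app f y) V (𝟙 V) y (by rw [Category.id_comp, M.res_id])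
    rwa [ModSheaf.res_id, Category.id_comp] at this
  refine ⟨(⟨fun {V} f => ⟨⟨s f, fun x x' => ?_⟩, fun r x => ?_⟩, fun {V W} f g x => ?_⟩ :
    LinMap M (baseMod R) U), fun V f y => happ f y⟩
  · obtain ⟨S, hS, hy⟩ := hπ V f x
    obtain ⟨T, hT, hy'⟩ := hπ V f x'
    refine (baseMod R).ext_of_cover (J.intersection_covering hS hT) fun Z k hk => ?_
    obtain ⟨y, hy⟩ := hy Z k hk.1
    obtain ⟨y', hy'⟩ := hy' Z k hk.2
    rw [map_add, hres, hres, hres, map_add, ← hy, ← hy', ← map_add, happ, happ, happ, map_add]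
  · obtain ⟨S, hS, hy⟩ := hπ V f x
    refine (baseMod R).ext_of_cover hS fun Z k hk => ?_
    obtain ⟨y, hy⟩ := hy Z k hk
    rw [RingHom.id_apply, ModSheaf.res_smul, hres, hres, M.res_smul, ← hy, ← map_smul, happ, happ,
      map_smul]
  · exact hres f g x

end DualModules

/-! ### Exactness of the dual sequence and reflexivity -/

section Duality

variable {C : Type u} [SmallCategory C] {J : GrothendieckTopology C} {R : Sheaf J CommRingCat.{u}}
variable {M : ModSheaf R} {U V W : C} {n m : ℕ}

/-- The matrix of a linear map `Rⁿ → Rᵐ`. -/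
noncomputable def LinMap.matrix (P : LinMap (freeMod R n) (freeMod R m) U) (i : Fin m) (j : Fin n) :
    ringSec R U :=
  freeCoord i (P.app (𝟙 U) (freeBasis R U j))

theorem LinMap.freeCoord_app (P : LinMap (freeMod R n) (freeMod R m) U) (f : V ⟶ U)
    (x : (freeMod R n).sec V) (i : Fin m) :
    freeCoord i (P.app f x) = ∑ j, ringRes R f (P.matrix i j) * freeCoord j x := by
  rw [P.app_free, map_sum]
  refine Finset.sum_congr rfl fun j _ => ?_
  rw [map_smul, freeCoord_res, smul_eq_mul, mul_comm]
  rfl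

theorem LinMap.app_eq_zero_iff (P : LinMap (freeMod R n) (freeMod R m) U) (f : V ⟶ U)
    (x : Fin n → ringSec R V) : P.app f (freeMk x) = 0 ↔
      ∀ i, MvPolynomial.eval x (MvPolynomial.map (ringRes R f) (rowForms P.matrix i)) = 0 := by
  simp only [eval_map_rowForms]
  constructor
  · intro h i
    have := P.freeCoord_app f (freeMk x) i
    rw [h, map_zero] at this
    exact this.symm
  · intro h
    refine freeMod_ext fun i => ?_
    rw [P.freeCoord_app, map_zero]
    exact h i

/-- A functional on the kernel of `P : Rⁿ → Rᵐ` locally extends to `Rⁿ`. -/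
theorem SatisfiesDuality.exists_extension (hR : SatisfiesDuality R)
    {φ : LinMap M (freeMod R n) U} {P : LinMap (freeMod R n) (freeMod R m) U}
    (hφ : φ.IsInjective) (h : LinMap.IsExact φ P) (ξ : (dual M).sec U) :
    ∃ S ∈ J U, ∀ (V : C) (f : V ⟶ U), S f → ∃ a : (freeMod R n).sec V,
      φ.dualMap.app f ((freeToDual R n V).app (𝟙 V) a) = (dual M).res f ξ := by
  -- Points of the spectrum are vectors killed by `P`, hence elements of `M`; through this bijection
  -- `ξ` becomes a homogeneous function on the spectrum.
  have key : ∀ {V : C} (f : V ⟶ U) (x : SpecPoints R (rowForms P.matrix) f),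
      ∃ y : M.sec V, φ.app f y = freeMk x.1 := fun f x =>
    h.exists_app_eq hφ f ((P.app_eq_zero_iff f x.1).2 x.2)
  choose pre hpre using @key
  have hmul : ∀ {V : C} (f : V ⟶ U) (x : SpecPoints R (rowForms P.matrix) f) (y : M.sec V)
      (_ : φ.app f y = freeMk x.1), pre f x = y := fun f x y hy =>
    hφ.app_injective f ((hpre f x).trans hy.symm)
  let s : SpecFun R (rowForms P.matrix) :=
    { app := fun {V} f x => (show ringSec R V from dualApp ξ f (pre f x))
      naturality := fun {V W} f g x => by
        rw [hmul (g ≫ f) (x.res g) (M.res g (pre f x))]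
        · exact res_dualApp ξ f g _
        · rw [← φ.naturality, hpre]
          rfl }
  obtain ⟨S, hS, hs⟩ := hR.exists_linearForm P.matrix s fun V f r x y hxy => by
    change dualApp ξ f (pre f y) = r • dualApp ξ f (pre f x)
    rw [← map_smul, hmul f y (r • pre f x)]
    rw [map_smul, hpre]
    exact freeMod_ext fun j => (hxy j).symm
  refine ⟨S, hS, fun V f hf => ?_⟩
  obtain ⟨a, ha⟩ := hs V f hf
  refine ⟨freeMk a, dual_ext fun W g y => ?_⟩
  rw [dualApp_dualMap, dualApp_freeToDual, dualApp_res]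
  let x : SpecPoints R (rowForms P.matrix) (g ≫ f) :=
    ⟨fun j => freeCoord j (φ.app (g ≫ f) y), (P.app_eq_zero_iff _ _).1 (h.app_app (g ≫ f) y)⟩
  have hx := ha W g x
  have h2 : s.app (g ≫ f) x = dualApp ξ (g ≫ f) y :=
    congrArg (dualApp ξ (g ≫ f)) (hmul (g ≫ f) x y rfl)
  refine Eq.trans ?_ (hx.symm.trans h2)
  exact Finset.sum_congr rfl fun j _ => mul_comm (G := ringSec R W) _ _

/-- A functional on `Rⁿ` that vanishes on the kernel of `P : Rⁿ → Rᵐ` locally factors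
through `P`. -/
theorem SatisfiesDuality.exists_factorization (hR : SatisfiesDuality R)
    (P : LinMap (freeMod R n) (freeMod R m) U) (η : (dual (freeMod R n)).sec U)
    (h : ∀ (V : C) (f : V ⟶ U) (x : (freeMod R n).sec V), P.app f x = 0 → dualApp η f x = 0) :
    ∃ S ∈ J U, ∀ (V : C) (f : V ⟶ U), S f → ∃ ζ : (dual (freeMod R m)).sec V,
      P.dualMap.app f ζ = (dual (freeMod R n)).res f η := by
  obtain ⟨a, rfl⟩ := freeToDual_surjective n (𝟙 U) η
  have hval : ∀ {V : C} (f : V ⟶ U) (x : (freeMod R n).sec V),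
      dualApp ((freeToDual R n U).app (𝟙 U) a) f x =
        (show ringSec R V from ∑ j, ringRes R f (freeCoord j a) * freeCoord j x) := fun f x => by
    rw [dualApp_freeToDual]
    exact Finset.sum_congr rfl fun j _ => mul_comm (G := ringSec R _) _ _
  obtain ⟨S, hS, hc⟩ := hR.exists_rowCombination P.matrix (fun j => freeCoord j a)
    fun V f x hx => by
      refine (hval f (freeMk x)).symm.trans (h V f (freeMk x) ((P.app_eq_zero_iff f x).2 ?_))
      intro i
      rw [eval_map_rowForms]
      exact hx i
  refine ⟨S, hS, fun V f hf => ?_⟩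
  obtain ⟨c, hc⟩ := hc V f hf
  refine ⟨(freeToDual R m V).app (𝟙 V) (freeMk c), dual_ext fun W g x => ?_⟩
  rw [dualApp_dualMap, dualApp_res, hval, dualApp_freeToDual]
  simp only [LinMap.freeCoord_app, freeCoord_freeMk, ringRes_comp, hc, map_sum, map_mul,
    Finset.sum_mul]
  rw [Finset.sum_comm]
  exact Finset.sum_congr rfl fun j _ => Finset.sum_congr rfl fun i _ =>
    ((mul_comm (G := ringSec R W) _ _).trans (mul_assoc (G := ringSec R W) _ _ _).symm)

theorem LinMap.IsExact.dualMap_dualMap {N K : ModSheaf R} {φ : LinMap M N U} {P : LinMap N K U}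
    (h : LinMap.IsExact φ P) (f : V ⟶ U) (ζ : (dual K).sec V) :
    φ.dualMap.app f (P.dualMap.app f ζ) = 0 := dual_ext fun W g x => by
  rw [dualApp_dualMap, dualApp_dualMap, h.app_app, map_zero, dualApp_zero, LinearMap.zero_apply]

theorem SatisfiesDuality.isSurjective_dualMap (hR : SatisfiesDuality R)
    {φ : LinMap M (freeMod R n) U} {P : LinMap (freeMod R n) (freeMod R m) U}
    (hφ : φ.IsInjective) (h : LinMap.IsExact φ P) : φ.dualMap.IsSurjective := by
  intro V f ξ
  obtain ⟨S, hS, hs⟩ := hR.exists_extension (hφ.res f) (h.res f) ξ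
  refine ⟨S, hS, fun W g hg => ?_⟩
  obtain ⟨a, ha⟩ := hs W g hg
  refine ⟨(freeToDual R n W).app (𝟙 W) a, Eq.trans (dual_ext fun Z k x => ?_) ha⟩
  rw [dualApp_dualMap, dualApp_dualMap, LinMap.res_app, Category.assoc]

theorem SatisfiesDuality.isExact_dualMap (hR : SatisfiesDuality R)
    {φ : LinMap M (freeMod R n) U} {P : LinMap (freeMod R n) (freeMod R m) U}
    (hφ : φ.IsInjective) (h : LinMap.IsExact φ P) : LinMap.IsExact P.dualMap φ.dualMap := by
  intro V f η
  constructor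
  · intro hη
    obtain ⟨S, hS, hs⟩ := hR.exists_factorization (LinMap.res f P) η fun W g x hx => by
      obtain ⟨y, rfl⟩ := h.exists_app_eq hφ (g ≫ f) hx
      rw [← dualApp_dualMap φ f, hη]
      rfl
    refine ⟨S, hS, fun W g hg => ?_⟩
    obtain ⟨ζ, hζ⟩ := hs W g hg
    refine ⟨ζ, Eq.trans (dual_ext fun Z k x => ?_) hζ⟩
    rw [dualApp_dualMap, dualApp_dualMap, LinMap.res_app, Category.assoc]
  · rintro ⟨S, hS, hs⟩
    refine (dual M).ext_of_cover hS fun W g hg => ?_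
    obtain ⟨ζ, hζ⟩ := hs W g hg
    rw [φ.dualMap.naturality, ← hζ, map_zero, h.dualMap_dualMap]

theorem SatisfiesDuality.isFinPresented_dual (hR : SatisfiesDuality R) (h : IsFinCopresented M U) :
    IsFinPresented (dual M) U := by
  obtain ⟨S, hS, h⟩ := h
  refine ⟨S, hS, fun V f hf => ?_⟩
  obtain ⟨n, m, φ, P, hφ, hP⟩ := h V f hf
  -- The relations are the transpose of `P`; the generators are the coordinate functionals pulled
  -- back along `φ`.
  refine ⟨n, m, evalTuple (fun j => P.app (𝟙 V) (freeBasis R V j)) |>.comp (freeToDual R m V),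
    φ.dualMap.comp (freeToDual R n V), fun W g y => ?_, fun W g ξ => ?_⟩
  · refine (hR.isExact_dualMap hφ hP W g _).trans ?_
    refine exists_congr fun T => and_congr_right fun _ => forall_congr' fun Z =>
      forall_congr' fun k => forall_congr' fun _ => ?_
    rw [LinMap.naturality]
    constructor
    · rintro ⟨ζ, hζ⟩
      obtain ⟨z, rfl⟩ := freeToDual_surjective m (k ≫ g) ζ
      refine ⟨z, (freeToDual_injective n V).app_injective (k ≫ g) ?_⟩
      rw [← hζ, ← freeToDual_evalTuple]
      rfl
    · rintro ⟨z, hz⟩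
      refine ⟨(freeToDual R m V).app (k ≫ g) z, ?_⟩
      rw [← hz, ← freeToDual_evalTuple]
      rfl
  · obtain ⟨T, hT, hs⟩ := hR.isSurjective_dualMap hφ hP W g ξ
    refine ⟨T, hT, fun Z k hk => ?_⟩
    obtain ⟨η, hη⟩ := hs Z k hk
    obtain ⟨z, rfl⟩ := freeToDual_surjective n (k ≫ g) η
    exact ⟨z, hη⟩

/-- A functional on `(Rⁿ)^⋆` is evaluation at a section of `Rⁿ`. -/
theorem exists_eq_dualApp_of_doubleDual (Ψ : (dual (dual (freeMod R n))).sec U) :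
    ∃ y : (freeMod R n).sec U, ∀ (V : C) (f : V ⟶ U) (η : (dual (freeMod R n)).sec V),
      dualApp Ψ f η = dualApp η (𝟙 V) ((freeMod R n).res f y) := by
  -- Pulled back along `Rⁿ ≅ (Rⁿ)^⋆`, `Ψ` is a functional on `Rⁿ`; its coefficient vector is `y`.
  obtain ⟨y, hy⟩ := freeToDual_surjective n (𝟙 U) ((freeToDual R n U).dualMap.app (𝟙 U) Ψ)
  refine ⟨y, fun V f η => ?_⟩
  obtain ⟨a, rfl⟩ := freeToDual_surjective n f η
  rw [← dualApp_freeToDual_comm (𝟙 U), hy, dualApp_dualMap, Category.comp_id]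

theorem SatisfiesDuality.isIsomorphism_toDoubleDual_of_copresentation (hR : SatisfiesDuality R)
    {φ : LinMap M (freeMod R n) U} {P : LinMap (freeMod R n) (freeMod R m) U}
    (hφ : φ.IsInjective) (h : LinMap.IsExact φ P) : (LinMap.toDoubleDual M U).IsIsomorphism := by
  have hval : ∀ {V : C} (f : V ⟶ U) (y : (freeMod R n).sec V) (a : (freeMod R n).sec V),
      dualApp ((freeToDual R n U).app f a) (𝟙 V) y =
        dualApp ((freeToDual R n U).app f y) (𝟙 V) a := fun f y a => by
    rw [dualApp_freeToDual_comm f f, ModSheaf.res_id]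
  refine fun V f => ⟨(injective_iff_map_eq_zero _).2 fun x hx => hφ V f x ?_, fun Θ => ?_⟩
  · refine freeToDual_injective n U V f _ (dual_ext fun W g a => ?_)
    rw [dualApp_freeToDual_comm f (g ≫ f), φ.naturality]
    have := LinearMap.congr_fun (congrArg (fun Θ => dualApp Θ g) hx)
      (φ.dualMap.app (g ≫ f) ((freeToDual R n U).app (g ≫ f) a))
    rw [dualApp_toDoubleDual, dualApp_dualMap, Category.id_comp] at this
    exact this
  · obtain ⟨y, hy⟩ := exists_eq_dualApp_of_doubleDual (φ.dualMap.dualMap.app f Θ)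
    -- Every functional `ζ` on `Rᵐ` takes the value `Θ(φ^⋆ P^⋆ ζ) = 0` at `P y`.
    have hy0 : P.app f y = 0 := by
      refine freeToDual_injective m U V f _ (dual_ext fun W g a => ?_)
      rw [dualApp_freeToDual_comm f (g ≫ f), P.naturality]
      have := hy W g (P.dualMap.app (g ≫ f) ((freeToDual R m U).app (g ≫ f) a))
      rw [dualApp_dualMap (P), Category.id_comp] at this
      rw [← this, dualApp_dualMap]
      rw [h.dualMap_dualMap, map_zero, dualApp_zero, LinearMap.zero_apply]
    obtain ⟨x, rfl⟩ := h.exists_app_eq hφ f hy0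
    refine ⟨x, dual_ext fun W g ξ => ?_⟩
    -- Locally `ξ` extends to `Rⁿ`, where the image of `Θ` is evaluation at `φ(x)`.
    obtain ⟨S, hS, hs⟩ := hR.isSurjective_dualMap hφ h W (g ≫ f) ξ
    refine (baseMod R).ext_of_cover hS fun Z k hk => ?_
    obtain ⟨η, hη⟩ := hs Z k hk
    rw [res_dualApp, res_dualApp, ← hη]
    have := hy Z (k ≫ g) η
    rw [dualApp_dualMap, Category.assoc] at this
    rw [this, dualApp_toDoubleDual, dualApp_dualMap, φ.naturality, Category.id_comp,
      Category.assoc]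

theorem LinMap.IsSurjective.res {N : ModSheaf R} {π : LinMap N M U} (hπ : π.IsSurjective)
    (f : V ⟶ U) : (LinMap.res f π).IsSurjective := fun W g x => by
  simpa only [LinMap.res_app, Category.assoc] using hπ W (g ≫ f) x

theorem LinMap.IsSurjective.isInjective_dualMap {N : ModSheaf R} {π : LinMap N M U}
    (hπ : π.IsSurjective) : π.dualMap.IsInjective := fun V f ξ h0 => by
  refine dual_ext fun W g x => ?_
  obtain ⟨S, hS, hs⟩ := hπ W (g ≫ f) x
  refine (baseMod R).ext_of_cover hS fun Z k hk => ?_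
  obtain ⟨y, hy⟩ := hs Z k hk
  rw [res_dualApp, ← hy, dualApp_zero, LinearMap.zero_apply, map_zero, ← Category.assoc,
    ← dualApp_dualMap, h0, dualApp_zero, LinearMap.zero_apply]

/-- The functor `M ↦ M^⋆` takes right exact sequences to left exact ones. -/
theorem LinMap.IsExact.exists_dualMap_eq {N K : ModSheaf R} {ρ : LinMap K N U} {π : LinMap N M U}
    (h : LinMap.IsExact ρ π) (hπ : π.IsSurjective) (f : V ⟶ U) {η : (dual N).sec V}
    (hη : ρ.dualMap.app f η = 0) : ∃ ξ, π.dualMap.app f ξ = η := by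
  obtain ⟨ξ, hξ⟩ := (hπ.res f).exists_descent η fun W g y hy => by
    obtain ⟨S, hS, hs⟩ := (h W (g ≫ f) y).1 hy
    refine (baseMod R).ext_of_cover hS fun Z k hk => ?_
    obtain ⟨z, hz⟩ := hs Z k hk
    rw [res_dualApp, ← hz, map_zero, ← Category.assoc, ← dualApp_dualMap, hη, dualApp_zero,
      LinearMap.zero_apply]
  exact ⟨ξ, dual_ext fun W g y => hξ W g y⟩

theorem isInjective_evalTuple_of_isSurjective {π : LinMap (freeMod R n) M U}
    (hπ : π.IsSurjective) :
    (evalTuple fun j => π.app (𝟙 U) (freeBasis R U j)).IsInjective := fun V f ξ hξ => by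
  refine hπ.isInjective_dualMap V f ξ ?_
  rw [← freeToDual_evalTuple, hξ, map_zero]

theorem LinMap.comp_app {N K : ModSheaf R} (ψ : LinMap N K U) (φ : LinMap M N U) (f : V ⟶ U)
    (x : M.sec V) : (ψ.comp φ).app f x = ψ.app f (φ.app f x) := rfl

/-- The transpose of a linear map `Rᵐ → Rⁿ`. -/
noncomputable def LinMap.transpose (ρ : LinMap (freeMod R m) (freeMod R n) U) :
    LinMap (freeMod R n) (freeMod R m) U :=
  (evalTuple fun j => ρ.app (𝟙 U) (freeBasis R U j)).comp (freeToDual R n U)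

theorem freeToDual_transpose (ρ : LinMap (freeMod R m) (freeMod R n) U) (f : V ⟶ U)
    (a : (freeMod R n).sec V) : (freeToDual R m U).app f (ρ.transpose.app f a) =
      ρ.dualMap.app f ((freeToDual R n U).app f a) := by
  rw [LinMap.transpose, LinMap.comp_app, freeToDual_evalTuple]

theorem transpose_dualMap_freeToDual (ρ : LinMap (freeMod R m) (freeMod R n) U) (f : V ⟶ U)
    (z : (freeMod R m).sec V) : ρ.transpose.dualMap.app f ((freeToDual R m U).app f z) =
      (freeToDual R n U).app f (ρ.app f z) :=
  dual_ext fun W g a => by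
    rw [dualApp_dualMap, dualApp_freeToDual_comm f (g ≫ f), freeToDual_transpose, dualApp_dualMap,
      dualApp_freeToDual_comm f (g ≫ f), ρ.naturality, Category.id_comp]

/-- A functional on `Rⁿ` descends to `M` exactly when it kills the image of `ρ`. With injectivity of
the evaluation map this is a copresentation of `M^⋆`. -/
theorem isExact_evalTuple_transpose {ρ : LinMap (freeMod R m) (freeMod R n) U}
    {π : LinMap (freeMod R n) M U} (h : LinMap.IsExact ρ π) (hπ : π.IsSurjective) :
    LinMap.IsExact (evalTuple fun j => π.app (𝟙 U) (freeBasis R U j)) ρ.transpose := fun V f a => by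
  constructor
  · intro ha
    obtain ⟨ξ, hξ⟩ := h.exists_dualMap_eq hπ f (η := (freeToDual R n U).app f a) (by
      rw [← freeToDual_transpose, ha, map_zero])
    refine ⟨⊤, J.top_mem V, fun W g _ => ⟨(dual M).res g ξ, ?_⟩⟩
    rw [← LinMap.naturality]
    congr 1
    refine (freeToDual_injective n U).app_injective f ?_
    rw [freeToDual_evalTuple, hξ]
  · rintro ⟨S, hS, hs⟩
    refine (freeMod R m).ext_of_cover hS fun W g hg => ?_
    obtain ⟨ξ, hξ⟩ := hs W g hg
    rw [LinMap.naturality, ← hξ, map_zero]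
    refine (freeToDual_injective m U).app_injective (g ≫ f) ?_
    rw [freeToDual_transpose, freeToDual_evalTuple, map_zero, h.dualMap_dualMap]

theorem SatisfiesDuality.isIsomorphism_toDoubleDual_of_presentation (hR : SatisfiesDuality R)
    {ρ : LinMap (freeMod R m) (freeMod R n) U} {π : LinMap (freeMod R n) M U}
    (h : LinMap.IsExact ρ π) (hπ : π.IsSurjective) : (LinMap.toDoubleDual M U).IsIsomorphism := by
  have hφ := isInjective_evalTuple_of_isSurjective hπ
  have hexact := isExact_evalTuple_transpose h hπ
  refine LinMap.IsIsomorphism.of_injective_of_surjective (fun V f x hx => ?_) fun V f Θ => ?_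
  · obtain ⟨S, hS, hs⟩ := hπ V f x
    refine M.ext_of_cover hS fun W g hg => ?_
    obtain ⟨y, hy⟩ := hs W g hg
    rw [map_zero, ← hy]
    have h0 := evalTuple_dualMap_freeToDual π (g ≫ f) y
    rw [ hy, ← LinMap.naturality, hx, map_zero] at h0
    -- The lift `y` of `x` dies in `M^⋆⋆`, so exactness of the dualised copresentation puts it
    -- locally in the image of the double transpose, which is `ρ`; hence `π(y) = 0`.
    obtain ⟨T, hT, ht⟩ := (hR.isExact_dualMap hφ hexact W (g ≫ f) _).1 h0
    refine (h W (g ≫ f) y).2 ⟨T, hT, fun Z k hk => ?_⟩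
    obtain ⟨ζ, hζ⟩ := ht Z k hk
    obtain ⟨z, rfl⟩ := (freeToDual_surjective m (k ≫ g ≫ f)) ζ
    refine ⟨z, (freeToDual_injective n U).app_injective (k ≫ g ≫ f) ?_⟩
    rw [← transpose_dualMap_freeToDual, hζ, LinMap.naturality]
  -- `Rⁿ ≅ (Rⁿ)^⋆ → M^⋆⋆` is locally onto and factors through `π`.
  · obtain ⟨S, hS, hs⟩ := hR.isSurjective_dualMap hφ hexact V f Θ
    refine ⟨S, hS, fun W g hg => ?_⟩
    obtain ⟨η, hη⟩ := hs W g hg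
    obtain ⟨y, rfl⟩ := freeToDual_surjective n (g ≫ f) η
    exact ⟨π.app (g ≫ f) y, by rw [← evalTuple_dualMap_freeToDual, hη]⟩

end Duality

theorem mainTheorem10 {C : Type u} [SmallCategory C] {J : GrothendieckTopology C}
    (R : Sheaf J CommRingCat.{u}) (hR : SatisfiesDuality R) (M : ModSheaf R) (U : C) :
    (∀ (n m : ℕ) (φ : LinMap M (freeMod R n) U) (P : LinMap (freeMod R n) (freeMod R m) U),
      φ.IsInjective → LinMap.IsExact φ P →
        LinMap.IsExact P.dualMap φ.dualMap ∧ φ.dualMap.IsSurjective) ∧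
    (IsFinCopresented M U → IsFinPresented (dual M) U) ∧
    (IsFinPresented M U ∨ IsFinCopresented M U →
      (LinMap.toDoubleDual M U).IsIsomorphism) := by
  refine ⟨fun n m φ P hφ h => ⟨hR.isExact_dualMap hφ h, hR.isSurjective_dualMap hφ h⟩,
    hR.isFinPresented_dual, ?_⟩
  rintro (⟨S, hS, h⟩ | ⟨S, hS, h⟩) <;>
    refine LinMap.IsIsomorphism.of_cover ⟨S, hS, fun V f hf => ?_⟩
  · obtain ⟨n, m, ρ, π, hρ, hπ⟩ := h V f hf
    exact hR.isIsomorphism_toDoubleDual_of_presentation hρ hπ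
  · obtain ⟨n, m, φ, P, hφ, hP⟩ := h V f hf
    exact hR.isIsomorphism_toDoubleDual_of_copresentation hφ hP
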